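/- Let $\mathcal H$ be a real Hilbert space with norm $\|\cdot\|$, and set $q := \tfrac12\|\cdot\|^2$. For a nonempty closed convex set $C\subseteq\mathcal H$, let $P_C$ be the projector onto $C$ (so $P_Cx$ is the unique point of $C$ nearest to $x$), and let $d_C$ be the distance function of $C$. An operator $T\colon\mathcal H\to\mathcal H$ is monotone if $\langle x-y, Tx-Ty\rangle\ge 0$ for all $x,y\in\mathcal H$. Let $(C_i)_{i\in I}$ be a finite family of nonempty closed convex subsets of $\mathcal H$, let $(\alpha_i)_{i\in I}$ be a family of real numbers, and set $\alpha := \sum_{i\in I}\alpha_i$ (empty sums are zero). Then there exists a nonempty closed convex set $C\subseteq\mathcal H$ such that $\sum_{i\in I}\alpha_iP_{C_i} = P_C$ if and only if $\sum_{i\in I}\alpha_iP_{C_i}$ is monotone and there exists $\gamma\in\mathbb R$ such that, for every $x\in\mathcal H$, $$(\alpha-1)\sum_{i\in I}\alpha_i\,q(P_{C_i}x) - \tfrac12\sum_{i\in I}\sum_{j\in I}\alpha_i\alpha_j\,q(P_{C_i}x-P_{C_j}x) = \gamma .$$ In that case, for every such $C$ and $\gamma$, $$d_C^2 = \sum_{i\in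 I}\alpha_i d_{C_i}^2 - 2(\alpha-1)q + 2\gamma \quad\text{on } \mathcal H.$$ -/

import Mathlib

open scoped InnerProductSpace

/-- The class of sets onto which one projects: nonempty, closed and convex. -/
def IsNonemptyClosedConvex {H : Type*} [NormedAddCommGroup H] [InnerProductSpace ℝ H]
    (C : Set H) : Prop :=
  C.Nonempty ∧ IsClosed C ∧ Convex ℝ C

/-- `p` is a nearest point of `C` to `x`: it lies in `C` and attains the distance `d_C(x)`. -/
def IsNearestPoint {H : Type*} [NormedAddCommGroup H] [InnerProductSpace ℝ H]
    (C : Set H) (x p : H) : Prop :=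
  p ∈ C ∧ ‖x - p‖ = Metric.infDist x C

open Classical in
/-- The projector `P_C`: it sends `x` to the nearest point of `C`, which exists and is unique
when `C` is a nonempty closed convex subset of a Hilbert space (see `projector_spec` and
`projector_eq`). If no nearest point exists, the (irrelevant) value is `x`. -/
noncomputable def projector {H : Type*} [NormedAddCommGroup H] [InnerProductSpace ℝ H]
    (C : Set H) (x : H) : H :=
  if h : ∃ p, IsNearestPoint C x p then h.choose else x

/-- The function `q = (1/2) ‖·‖²`. -/
noncomputable def halfSq {H : Type*} [NormedAddCommGroup H] [InnerProductSpace ℝ H]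
    (x : H) : ℝ :=
  (1 / 2) * ‖x‖ ^ 2

/-- Monotonicity of an operator in the Hilbert space sense:
`⟪x - y, T x - T y⟫ ≥ 0` for all `x`, `y`. -/
def IsMonotoneOperator {H : Type*} [NormedAddCommGroup H] [InnerProductSpace ℝ H]
    (T : H → H) : Prop :=
  ∀ x y : H, 0 ≤ ⟪x - y, T x - T y⟫_ℝ

theorem infDist_eq_iInf_norm {H : Type*} [NormedAddCommGroup H] [InnerProductSpace ℝ H]
    (C : Set H) (x : H) : Metric.infDist x C = ⨅ w : C, ‖x - w‖ := by
  simp only [Metric.infDist_eq_iInf, dist_eq_norm]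

theorem projector_spec {H : Type*} [NormedAddCommGroup H] [InnerProductSpace ℝ H]
    [CompleteSpace H] {C : Set H} (hC : IsNonemptyClosedConvex C) (x : H) :
    IsNearestPoint C x (projector C x) := by
  have h : ∃ p, IsNearestPoint C x p := by
    obtain ⟨p, hp, he⟩ :=
      exists_norm_eq_iInf_of_complete_convex hC.1 hC.2.1.isComplete hC.2.2 x
    exact ⟨p, hp, by rw [he, infDist_eq_iInf_norm]⟩
  unfold projector
  rw [dif_pos h]
  exact h.choose_spec

theorem projector_eq {H : Type*} [NormedAddCommGroup H] [InnerProductSpace ℝ H]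
    [CompleteSpace H] {C : Set H} (hC : IsNonemptyClosedConvex C) {x p : H}
    (hp : IsNearestPoint C x p) : projector C x = p := by
  have hq := projector_spec hC x
  have h1 := (norm_eq_iInf_iff_real_inner_le_zero hC.2.2 hp.1).1
    (by rw [hp.2, infDist_eq_iInf_norm]) _ hq.1
  have h2 := (norm_eq_iInf_iff_real_inner_le_zero hC.2.2 hq.1).1
    (by rw [hq.2, infDist_eq_iInf_norm]) _ hp.1
  have h3 : ⟪projector C x - p, projector C x - p⟫_ℝ ≤ 0 := by
    have e : ⟪projector C x - p, projector C x - p⟫_ℝ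
        = ⟪x - p, projector C x - p⟫_ℝ + ⟪x - projector C x, p - projector C x⟫_ℝ := by
      simp only [inner_sub_left, inner_sub_right, real_inner_comm]
      ring
    rw [e]
    linarith
  rw [real_inner_self_eq_norm_sq] at h3
  have h4 : ‖projector C x - p‖ = 0 := by nlinarith [norm_nonneg (projector C x - p)]
  exact sub_eq_zero.1 (norm_eq_zero.1 h4)

/-! Each `P_C` is the gradient of the convex function `f_C = q - d_C²/2`, so `T = ∑ αᵢ P_{Cᵢ}` is
the gradient of `F = ∑ αᵢ f_{Cᵢ}`. By `sum_projectorPotential`, the expression required to be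
constant is `F x - (⟪x, T x⟫ - q (T x))`. If `T = P_D`, this is `F - f_D`, whose gradient vanishes.
Conversely, constancy says that `h = F - γ` equals `⟪x, T x⟫ - q (T x)`, and monotonicity puts `h`
above its tangents; this forces `T` to be a projector (`exists_eq_projector_of_gradient`). Gradients
enter only as first-order expansions with quadratic error. -/

/-- The variational characterization of the projector. -/
theorem inner_sub_projector_le_zero {H : Type*} [NormedAddCommGroup H] [InnerProductSpace ℝ H]
    [CompleteSpace H] {C : Set H} (hC : IsNonemptyClosedConvex C) (x : H) {z : H} (hz : z ∈ C) :
    ⟪x - projector C x, z - projector C x⟫_ℝ ≤ 0 := by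
  have hp := projector_spec hC x
  exact (norm_eq_iInf_iff_real_inner_le_zero hC.2.2 hp.1).1
    (by rw [hp.2, infDist_eq_iInf_norm]) _ hz

theorem projector_firmly_nonexpansive {H : Type*} [NormedAddCommGroup H] [InnerProductSpace ℝ H]
    [CompleteSpace H] {C : Set H} (hC : IsNonemptyClosedConvex C) (x y : H) :
    ‖projector C x - projector C y‖ ^ 2 ≤ ⟪x - y, projector C x - projector C y⟫_ℝ := by
  have h1 := inner_sub_projector_le_zero hC x (projector_spec hC y).1
  have h2 := inner_sub_projector_le_zero hC y (projector_spec hC x).1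
  rw [← real_inner_self_eq_norm_sq]
  simp only [inner_sub_left, inner_sub_right, real_inner_comm] at *
  linarith

theorem norm_projector_sub_le {H : Type*} [NormedAddCommGroup H] [InnerProductSpace ℝ H]
    [CompleteSpace H] {C : Set H} (hC : IsNonemptyClosedConvex C) (x y : H) :
    ‖projector C x - projector C y‖ ≤ ‖x - y‖ := by
  have h1 := projector_firmly_nonexpansive hC x y
  have h2 := real_inner_le_norm (x - y) (projector C x - projector C y)
  by_contra! h
  nlinarith [norm_nonneg (x - y)]

theorem continuous_projector {H : Type*} [NormedAddCommGroup H] [InnerProductSpace ℝ H]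
    [CompleteSpace H] {C : Set H} (hC : IsNonemptyClosedConvex C) :
    Continuous (projector C) := by
  have : LipschitzWith 1 (projector C) := LipschitzWith.of_dist_le_mul fun x y => by
    simpa [dist_eq_norm] using norm_projector_sub_le hC x y
  exact this.continuous

/-- The function `q - d_C² / 2`, whose gradient is the projector `P_C`. -/
noncomputable def projectorPotential {H : Type*} [NormedAddCommGroup H] [InnerProductSpace ℝ H]
    (C : Set H) (x : H) : ℝ :=
  ⟪x, projector C x⟫_ℝ - halfSq (projector C x)

theorem halfSq_eq_inner {H : Type*} [NormedAddCommGroup H] [InnerProductSpace ℝ H] (x : H) :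
    halfSq x = (1 / 2) * ⟪x, x⟫_ℝ := by
  rw [halfSq, real_inner_self_eq_norm_sq]

theorem halfSq_nonneg {H : Type*} [NormedAddCommGroup H] [InnerProductSpace ℝ H] (x : H) :
    0 ≤ halfSq x := by
  unfold halfSq; positivity

theorem halfSq_sub {H : Type*} [NormedAddCommGroup H] [InnerProductSpace ℝ H] (x y : H) :
    halfSq (x - y) = halfSq x - ⟪x, y⟫_ℝ + halfSq y := by
  simp only [halfSq, norm_sub_sq_real]; ring

theorem infDist_sq_eq {H : Type*} [NormedAddCommGroup H] [InnerProductSpace ℝ H]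
    [CompleteSpace H] {C : Set H} (hC : IsNonemptyClosedConvex C) (x : H) :
    Metric.infDist x C ^ 2 = 2 * halfSq x - 2 * projectorPotential C x := by
  have h := halfSq_sub x (projector C x)
  rw [← (projector_spec hC x).2, projectorPotential]
  rw [halfSq] at h
  linarith

/-- The gap equals `q (y - P_C x) - q (y - P_C y)`, and `P_C y` is the point of `C` nearest to `y`.
-/
theorem projectorPotential_ge {H : Type*} [NormedAddCommGroup H] [InnerProductSpace ℝ H]
    [CompleteSpace H] {C : Set H} (hC : IsNonemptyClosedConvex C) (x y : H) :
    projectorPotential C x + ⟪projector C x, y - x⟫_ℝ ≤ projectorPotential C y := by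
  have h := inner_sub_projector_le_zero hC y (projector_spec hC x).1
  have h0 := halfSq_nonneg (projector C x - projector C y)
  simp only [projectorPotential, halfSq_eq_inner, inner_sub_left, inner_sub_right,
    real_inner_comm] at *
  linarith

/-- The tangent inequality at `x` bounds the error below by zero; the one at `y`, with
Cauchy-Schwarz and nonexpansiveness, bounds it above. -/
theorem abs_projectorPotential_sub_le {H : Type*} [NormedAddCommGroup H] [InnerProductSpace ℝ H]
    [CompleteSpace H] {C : Set H} (hC : IsNonemptyClosedConvex C) (x y : H) :
    |projectorPotential C y - projectorPotential C x - ⟪projector C x, y - x⟫_ℝ|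
      ≤ ‖y - x‖ ^ 2 := by
  have h1 := projectorPotential_ge hC x y
  have h2 := projectorPotential_ge hC y x
  have h3 := real_inner_le_norm (projector C y - projector C x) (y - x)
  have h4 := norm_projector_sub_le hC y x
  have h5 : ⟪projector C y, x - y⟫_ℝ
      = - ⟪projector C y - projector C x, y - x⟫_ℝ - ⟪projector C x, y - x⟫_ℝ := by
    rw [← neg_sub y x, inner_neg_right, inner_sub_left]; ring
  rw [abs_le]
  constructor <;> nlinarith [norm_nonneg (y - x)]

/-- A first-order expansion with a quadratic remainder gives the derivative along a line. -/
theorem hasDerivAt_line_of_quadratic_bound {H : Type*} [NormedAddCommGroup H]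
    [InnerProductSpace ℝ H] {T : H → H} {h : H → ℝ} {M : ℝ}
    (hM : ∀ x y, |h y - h x - ⟪T x, y - x⟫_ℝ| ≤ M * ‖y - x‖ ^ 2) (x v : H) (t : ℝ) :
    HasDerivAt (fun s : ℝ => h (x + s • v)) ⟪T (x + t • v), v⟫_ℝ t := by
  rw [hasDerivAt_iff_isLittleO]
  refine Asymptotics.IsBigO.trans_isLittleO (g := fun s : ℝ => (s - t) ^ 2) ?_ ?_
  · refine Asymptotics.IsBigO.of_bound (M * ‖v‖ ^ 2) (Filter.Eventually.of_forall fun s => ?_)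
    have e : x + s • v - (x + t • v) = (s - t) • v := by rw [sub_smul]; abel
    have := hM (x + t • v) (x + s • v)
    rw [e, inner_smul_right, norm_smul, mul_pow, Real.norm_eq_abs, sq_abs] at this
    rw [Real.norm_eq_abs, Real.norm_eq_abs, abs_of_nonneg (sq_nonneg (s - t)), smul_eq_mul]
    linarith
  · simpa using Asymptotics.isLittleO_pow_sub_sub t one_lt_two

theorem eq_of_quadratic_bound {H : Type*} [NormedAddCommGroup H] [InnerProductSpace ℝ H]
    {h : H → ℝ} {M : ℝ} (hM : ∀ x y, |h y - h x| ≤ M * ‖y - x‖ ^ 2) (x y : H) :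
    h x = h y := by
  have hd := hasDerivAt_line_of_quadratic_bound (T := fun _ => (0 : H)) (h := h) (M := M)
    (by simpa using hM) x (y - x)
  have := is_const_of_deriv_eq_zero (fun t => (hd t).differentiableAt)
    (fun t => by simpa using (hd t).deriv) 0 1
  simpa using this

/-- A differentiable function with monotone gradient lies above its tangents. -/
theorem gradient_inequality_of_monotone {H : Type*} [NormedAddCommGroup H]
    [InnerProductSpace ℝ H] {T : H → H} {h : H → ℝ} {M : ℝ} (hT : IsMonotoneOperator T)
    (hM : ∀ x y, |h y - h x - ⟪T x, y - x⟫_ℝ| ≤ M * ‖y - x‖ ^ 2) (x y : H) :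
    h x + ⟪T x, y - x⟫_ℝ ≤ h y := by
  have hd := hasDerivAt_line_of_quadratic_bound hM x (y - x)
  have hd' : ∀ t : ℝ, HasDerivAt (fun s : ℝ => h (x + s • (y - x)) - s * ⟪T x, y - x⟫_ℝ)
      (⟪T (x + t • (y - x)), y - x⟫_ℝ - 1 * ⟪T x, y - x⟫_ℝ) t := fun t =>
    (hd t).sub ((hasDerivAt_id t).mul_const _)
  have hmono : MonotoneOn (fun s : ℝ => h (x + s • (y - x)) - s * ⟪T x, y - x⟫_ℝ)
      (Set.Ici 0) := by
    refine monotoneOn_of_deriv_nonneg (convex_Ici 0)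
      (fun t _ => (hd' t).continuousAt.continuousWithinAt)
      (fun t _ => (hd' t).differentiableAt.differentiableWithinAt) fun t ht => ?_
    rw [interior_Ici] at ht
    have ht : 0 < t := ht
    rw [(hd' t).deriv]
    have := hT (x + t • (y - x)) x
    simp only [add_sub_cancel_left, inner_smul_left, RCLike.conj_to_real] at this
    have := nonneg_of_mul_nonneg_right this ht
    rw [real_inner_comm, inner_sub_left] at this
    linarith
  have := hmono (Set.mem_Ici.2 le_rfl) (Set.mem_Ici.2 zero_le_one) zero_le_one
  simp at this
  linarith

/-- If a function bounded below has first-order expansions with quadratic remainder, its gradient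
takes arbitrarily small values. -/
theorem exists_norm_gradient_lt {H : Type*} [NormedAddCommGroup H] [InnerProductSpace ℝ H]
    {T : H → H} {h : H → ℝ} {M : ℝ}
    (hM : ∀ x y, |h y - h x - ⟪T x, y - x⟫_ℝ| ≤ M * ‖y - x‖ ^ 2)
    (hb : BddBelow (Set.range h)) {ε : ℝ} (hε : 0 < ε) : ∃ w, ‖T w‖ < ε := by
  set K : ℝ := |M| + 1 with hK
  have hK0 : 0 < K := by positivity
  have hMK : M ≤ K := by have := le_abs_self M; linarith
  obtain ⟨w, hw⟩ := exists_lt_of_ciInf_lt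
    (show (⨅ w, h w) < (⨅ w, h w) + ε ^ 2 / (4 * K) by
      have : 0 < ε ^ 2 / (4 * K) := by positivity
      linarith)
  refine ⟨w, ?_⟩
  -- A gradient step of this size lowers `h` by at least `t/2 * ‖T w‖²`, but `w` is within `ε²/(4K)
  -- = t/2 * ε²` of the infimum.
  set t : ℝ := 1 / (2 * K) with ht
  have htK : t * K = 1 / 2 := by rw [ht]; field_simp
  have h1 := (abs_le.1 (hM w (w - t • T w))).2
  have h2 := ciInf_le hb (w - t • T w)
  rw [show w - t • T w - w = -(t • T w) by abel, inner_neg_right, inner_smul_right, norm_neg,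
    norm_smul, real_inner_self_eq_norm_sq, mul_pow, Real.norm_eq_abs, sq_abs] at h1
  have h3 : M * (t ^ 2 * ‖T w‖ ^ 2) ≤ K * (t ^ 2 * ‖T w‖ ^ 2) := by gcongr
  have h4 : K * (t ^ 2 * ‖T w‖ ^ 2) = 1 / 2 * (t * ‖T w‖ ^ 2) := by
    rw [← htK]; ring
  have h5 : ε ^ 2 / (4 * K) = 1 / 2 * (t * ε ^ 2) := by rw [ht]; field_simp; norm_num
  have h6 : t * ‖T w‖ ^ 2 < t * ε ^ 2 := by linarith
  have h7 : ‖T w‖ ^ 2 < ε ^ 2 := lt_of_mul_lt_mul_left h6 (by positivity)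
  exact lt_of_pow_lt_pow_left₀ 2 hε.le h7

/-- A continuous monotone operator `T` that is the gradient of `x ↦ ⟪x, T x⟫ - q (T x)` is the
projector onto its set of fixed points. -/
theorem exists_eq_projector_of_gradient {H : Type*} [NormedAddCommGroup H]
    [InnerProductSpace ℝ H] [CompleteSpace H] {T : H → H} (hT : IsMonotoneOperator T)
    (hc : Continuous T) {h : H → ℝ} (hh : ∀ x, h x = ⟪x, T x⟫_ℝ - halfSq (T x)) {M : ℝ}
    (hM : ∀ x y, |h y - h x - ⟪T x, y - x⟫_ℝ| ≤ M * ‖y - x‖ ^ 2) :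
    ∃ D : Set H, IsNonemptyClosedConvex D ∧ T = projector D := by
  have hlow : ∀ x y, ⟪y, T x⟫_ℝ - halfSq (T x) ≤ h y := fun x y => by
    have := gradient_inequality_of_monotone hT hM x y
    rw [hh x, inner_sub_right, real_inner_comm y, real_inner_comm x] at this
    linarith
  -- Since `q y - h y = q (y - T y)`, the affine minorants say that `T y` is a point of the range of
  -- `T` nearest to `y`.
  have hnear : ∀ x y, halfSq (y - T y) ≤ halfSq (y - T x) := fun x y => by
    have := hlow x y
    rw [hh] at this
    rw [halfSq_sub, halfSq_sub]
    linarith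
  have hfix : ∀ x, T (T x) = T x := fun x => by
    have := hnear x (T x)
    simp only [halfSq, sub_self, norm_zero] at this
    have h0 : ‖T x - T (T x)‖ = 0 := by nlinarith [norm_nonneg (T x - T (T x))]
    exact (sub_eq_zero.1 (norm_eq_zero.1 h0)).symm
  have hclosed : IsClosed {z | T z = z} := isClosed_eq hc continuous_id
  have hD : IsNonemptyClosedConvex {z | T z = z} := by
    refine ⟨⟨T 0, hfix 0⟩, hclosed, ?_⟩
    intro z₁ hz₁ z₂ hz₂ a b ha hb _
    -- The minorants at `z₁` and `z₂` bound `h - ⟪·, z⟫` below, so its gradient `T w - z` gets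
    -- arbitrarily small; each `T w` is a fixed point.
    refine hclosed.closure_subset (Metric.mem_closure_iff.2 fun ε hε => ?_)
    set z := a • z₁ + b • z₂
    have hab : ∀ w, h w - ⟪w, z⟫_ℝ ≥ (1 - a - b) * h w - a * halfSq z₁ - b * halfSq z₂ := by
      intro w
      have h1 := hlow z₁ w
      have h2 := hlow z₂ w
      rw [show T z₁ = z₁ from hz₁] at h1
      rw [show T z₂ = z₂ from hz₂] at h2
      rw [inner_add_right, inner_smul_right, inner_smul_right]
      nlinarith
    obtain ⟨w, hw⟩ := exists_norm_gradient_lt (T := fun w => T w - z)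
      (h := fun w => h w - ⟪w, z⟫_ℝ) (M := M)
      (fun x y => by
        have e : h y - ⟪y, z⟫_ℝ - (h x - ⟪x, z⟫_ℝ) - ⟪T x - z, y - x⟫_ℝ
            = h y - h x - ⟪T x, y - x⟫_ℝ := by
          rw [inner_sub_left (T x), inner_sub_right z, real_inner_comm z x, real_inner_comm z y]
          ring
        rw [e]
        exact hM x y)
      ⟨- a * halfSq z₁ - b * halfSq z₂, by
        rintro _ ⟨w, rfl⟩
        have := hab w
        rw [show 1 - a - b = 0 by linarith] at this
        linarith⟩ hε
    exact ⟨T w, hfix w, by rwa [dist_comm, dist_eq_norm]⟩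
  refine ⟨_, hD, funext fun x => (projector_eq hD ⟨hfix x, le_antisymm ?_ ?_⟩).symm⟩
  · refine (Metric.le_infDist hD.1).2 fun z hz => ?_
    have := hnear z x
    rw [show T z = z from hz, halfSq, halfSq] at this
    rw [dist_eq_norm]
    exact le_of_sq_le_sq (by linarith) (norm_nonneg _)
  · rw [← dist_eq_norm]
    exact Metric.infDist_le_dist_of_mem (hfix x)

/-- Polarization of each `q (p i - p j)`; the weights need not sum to one. -/
theorem halfSq_sum_smul {H : Type*} [NormedAddCommGroup H] [InnerProductSpace ℝ H]
    {ι : Type*} [Fintype ι] (α : ι → ℝ) (p : ι → H) :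
    halfSq (∑ i, α i • p i) = (∑ i, α i) * (∑ i, α i * halfSq (p i))
      - (1 / 2) * (∑ i, ∑ j, α i * α j * halfSq (p i - p j)) := by
  have h1 : ∑ i, ∑ j, α i * α j * halfSq (p i - p j)
      = ∑ i, ∑ j, (α i * (α j * halfSq (p j)) + α i * halfSq (p i) * α j
        - α i * (α j * ⟪p i, p j⟫_ℝ)) := by
    refine Finset.sum_congr rfl fun i _ => Finset.sum_congr rfl fun j _ => ?_
    rw [halfSq_sub]; ring
  have h2 : ⟪∑ i, α i • p i, ∑ j, α j • p j⟫_ℝ = ∑ i, α i * ∑ j, α j * ⟪p i, p j⟫_ℝ := by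
    rw [sum_inner]
    refine Finset.sum_congr rfl fun i _ => ?_
    rw [real_inner_smul_left, inner_sum]
    simp only [real_inner_smul_right]
  rw [h1, halfSq_eq_inner, h2]
  simp only [Finset.sum_sub_distrib, Finset.sum_add_distrib, ← Finset.mul_sum, ← Finset.sum_mul]
  ring

theorem sum_projectorPotential {H : Type*} [NormedAddCommGroup H] [InnerProductSpace ℝ H]
    {ι : Type*} [Fintype ι] (C : ι → Set H) (α : ι → ℝ) (x : H) :
    ((∑ i, α i) - 1) * (∑ i, α i * halfSq (projector (C i) x))
        - (1 / 2) * (∑ i, ∑ j, α i * α j * halfSq (projector (C i) x - projector (C j) x))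
      = ∑ i, α i * projectorPotential (C i) x
        - (⟪x, ∑ i, α i • projector (C i) x⟫_ℝ - halfSq (∑ i, α i • projector (C i) x)) := by
  rw [halfSq_sum_smul]
  simp only [projectorPotential, inner_sum, inner_smul_right, mul_sub, Finset.sum_sub_distrib]
  ring

theorem abs_sum_projectorPotential_sub_le {H : Type*} [NormedAddCommGroup H]
    [InnerProductSpace ℝ H] [CompleteSpace H] {ι : Type*} [Fintype ι] {C : ι → Set H}
    (hC : ∀ i, IsNonemptyClosedConvex (C i)) (α : ι → ℝ) (x y : H) :
    |∑ i, α i * projectorPotential (C i) y - ∑ i, α i * projectorPotential (C i) x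
        - ⟪∑ i, α i • projector (C i) x, y - x⟫_ℝ| ≤ (∑ i, |α i|) * ‖y - x‖ ^ 2 := by
  rw [sum_inner, ← Finset.sum_sub_distrib, ← Finset.sum_sub_distrib, Finset.sum_mul]
  refine (Finset.abs_sum_le_sum_abs _ _).trans (Finset.sum_le_sum fun i _ => ?_)
  rw [real_inner_smul_left, ← mul_sub, ← mul_sub, abs_mul]
  exact mul_le_mul_of_nonneg_left (abs_projectorPotential_sub_le (hC i) x y) (abs_nonneg _)

theorem theoremt {H : Type*} [NormedAddCommGroup H] [InnerProductSpace ℝ H] [CompleteSpace H]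
    {ι : Type*} [Fintype ι] (C : ι → Set H) (hC : ∀ i, IsNonemptyClosedConvex (C i))
    (α : ι → ℝ) :
    ((∃ D : Set H, IsNonemptyClosedConvex D ∧
        (fun x => ∑ i, α i • projector (C i) x) = projector D) ↔
      (IsMonotoneOperator (fun x : H => ∑ i, α i • projector (C i) x) ∧
        ∃ γ : ℝ, ∀ x : H,
          ((∑ i, α i) - 1) * (∑ i, α i * halfSq (projector (C i) x))
            - (1 / 2) * (∑ i, ∑ j, α i * α j *
                halfSq (projector (C i) x - projector (C j) x)) = γ)) ∧
    (∀ D : Set H, IsNonemptyClosedConvex D →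
      (fun x => ∑ i, α i • projector (C i) x) = projector D →
      ∀ γ : ℝ, (∀ x : H,
          ((∑ i, α i) - 1) * (∑ i, α i * halfSq (projector (C i) x))
            - (1 / 2) * (∑ i, ∑ j, α i * α j *
                halfSq (projector (C i) x - projector (C j) x)) = γ) →
      ∀ x : H, Metric.infDist x D ^ 2
        = (∑ i, α i * Metric.infDist x (C i) ^ 2)
          - 2 * ((∑ i, α i) - 1) * halfSq x + 2 * γ) := by
  refine ⟨⟨?_, ?_⟩, ?_⟩
  · rintro ⟨D, hD, hT⟩
    have hTx : ∀ x, ∑ i, α i • projector (C i) x = projector D x := congrFun hT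
    refine ⟨hT ▸ fun x y => (sq_nonneg _).trans (projector_firmly_nonexpansive hD x y),
      ∑ i, α i * projectorPotential (C i) 0 - projectorPotential D 0, fun x => ?_⟩
    rw [sum_projectorPotential, hTx x]
    refine eq_of_quadratic_bound (h := fun x => ∑ i, α i * projectorPotential (C i) x
      - projectorPotential D x) (M := ∑ i, |α i| + 1) (fun x y => ?_) x 0
    have h1 := abs_le.1 (abs_sum_projectorPotential_sub_le hC α x y)
    have h2 := abs_le.1 (abs_projectorPotential_sub_le hD x y)
    rw [hTx x] at h1
    rw [abs_le]
    constructor <;> linarith [h1.1, h1.2, h2.1, h2.2]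
  · rintro ⟨hT, γ, hγ⟩
    refine exists_eq_projector_of_gradient hT
      (continuous_finsetSum _ fun i _ => (continuous_projector (hC i)).const_smul (α i))
      (h := fun x => ∑ i, α i * projectorPotential (C i) x - γ) (fun x => ?_)
      (M := ∑ i, |α i|) (fun x y => ?_)
    · have := hγ x
      rw [sum_projectorPotential] at this
      linarith
    · rw [sub_sub_sub_cancel_right]
      exact abs_sum_projectorPotential_sub_le hC α x y
  · intro D hD hT γ hγ x
    have hx := hγ x
    rw [sum_projectorPotential, show ∑ i, α i • projector (C i) x = projector D x from
      congrFun hT x] at hx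
    -- Substituting `d² = 2q - 2f` for every set turns `F - f_D = γ` into the distance formula.
    rw [infDist_sq_eq hD]
    simp only [infDist_sq_eq (hC _), mul_sub, Finset.sum_sub_distrib, ← Finset.sum_mul]
    have e : ∑ i, α i * (2 * projectorPotential (C i) x)
        = 2 * ∑ i, α i * projectorPotential (C i) x := by
      rw [Finset.mul_sum]; exact Finset.sum_congr rfl fun i _ => by ring
    rw [e]
    rw [projectorPotential]
    linarith
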